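/- Notation. The Carter diagram $D_l(a_k)$ ($1\le k\le l-3$) has the $l$ vertices $\alpha_2,\alpha_3,\tau_0=\beta_1,\tau_1,\dots,\tau_{k-1},\varphi_0=\beta_2,\varphi_1,\dots,\varphi_{l-k-3}$. Its edges are those of the two chains $\tau_0-\tau_1-\dots-\tau_{k-1}$ and $\varphi_0-\varphi_1-\dots-\varphi_{l-k-3}$ and of the $4$-cycle $\beta_1,\alpha_2,\beta_2,\alpha_3$. All edges are solid except $\{\alpha_3,\beta_2\}$, which is dotted. The Dynkin diagram $D_l$ has the vertices $\alpha_2,\alpha_3,\tau_0=\beta_1,\tau_1,\dots,\tau_{l-3}$ and the solid edges $\{\alpha_2,\beta_1\}$, $\{\alpha_3,\beta_1\}$, $\{\tau_{i-1},\tau_i\}$. The partial Cartan matrix $B_L$ of such a diagram $\Gamma$ has the entry $2$ on the diagonal, $-1$ for a solid edge, $+1$ for a dotted edge, and $0$ otherwise. A nonzero integer vector $\gamma^\vee$ indexed by the vertices of $\Gamma$ is a linkage labels vector (linkage diagram) of $\Gamma$ if in some simply-laced root system, with roots of squared length $2$, there are linearly independent roots indexed by the vertices of $\Gamma$ with Gram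 matrix $B_L$, and a root $\gamma$ linearly independent of them, such that $\gamma^\vee_v=(\gamma,v)$ for every vertex $v$ (a vertex being identified with its root). The linkage system of $\Gamma$ is the graph whose nodes are the linkage labels vectors; two distinct nodes are joined by an edge marked $u$, for a vertex $u$, if they are exchanged by the dual reflection $s_u^*$, $(s_u^*x)_v=x_v-x_u(B_L)_{uv}$. The dual partial Weyl group is the group generated by all $s_u^*$. Write $\delta_v$ for the vector with entry $1$ at $v$ and $0$ elsewhere. Proposition. 1) For $1\le k\le l-3$ the four vectors $\pm\delta_{\tau_{k-1}}$ and $\pm\delta_{\varphi_{l-k-3}}$ are linkage labels vectors of $D_l(a_k)$. 2) Let $l>7$ and $1\le k\le l-3$, and put $p=k$, $q=l-k-2$. The linkage labels vectors of $D_l(a_k)$ are exactly the following $2l$ pairwise distinct vectors, where $\varepsilon=\pm1$: $$T^\varepsilon_0=\varepsilon(\delta_{\alpha_2}+\delta_{\alpha_3}-\delta_{\tau_0}),\qquad T^\varepsilon_j=\varepsilon(\delta_{\tau_{j-1}}-\delta_{\tau_j})\ (1\le j\le p-1),\qquad T^\varepsilon_p=\varepsilon\,\delta_{\tau_{p-1}},$$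 $$F^\varepsilon_0=\varepsilon(\delta_{\alpha_3}-\delta_{\alpha_2}+\delta_{\varphi_0}),\qquad F^\varepsilon_j=\varepsilon(\delta_{\varphi_j}-\delta_{\varphi_{j-1}})\ (1\le j\le q-1),\qquad F^\varepsilon_q=-\varepsilon\,\delta_{\varphi_{q-1}}.$$ The linkage system of $D_l(a_k)$ is the following "wind rose": its edges are exactly $T^\varepsilon_j - T^\varepsilon_{j+1}$ with mark $\tau_j$ ($0\le j<p$), $F^\varepsilon_j - F^\varepsilon_{j+1}$ with mark $\varphi_j$ ($0\le j<q$), $T^\varepsilon_0 - F^\varepsilon_0$ with mark $\alpha_2$, and $T^\varepsilon_0 - F^{-\varepsilon}_0$ with mark $\alpha_3$. So it is a square of inner nodes from which four arms go out. It is a single orbit of the dual partial Weyl group. 3) For $l>7$ the same holds for $D_l$, with $p=l-2$ and $q=0$: the linkage labels vectors are exactly the $2l$ pairwise distinct vectors $T^\varepsilon_j$ ($0\le j\le l-2$) and $F^\varepsilon_0=\varepsilon(\delta_{\alpha_3}-\delta_{\alpha_2})$. The edges of the linkage system are exactly $T^\varepsilon_j - T^\varepsilon_{j+1}$ with mark $\tau_j$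 ($0\le j<l-2$), $T^\varepsilon_0 - F^\varepsilon_0$ with mark $\alpha_2$, and $T^\varepsilon_0 - F^{-\varepsilon}_0$ with mark $\alpha_3$, and it is a single orbit of the dual partial Weyl group. -/

import Mathlib

noncomputable section

open Module

/-! ### Signed diagrams, partial Cartan matrices, linkage labels vectors -/

/-- A simply-laced diagram with solid and dotted edges, such as a Carter diagram. -/
structure SignedDiagram (V : Type) where
  solid : SimpleGraph V
  dotted : SimpleGraph V
  disjoint : Disjoint solid dotted

namespace SignedDiagram

variable {V : Type} (Γ : SignedDiagram V)

open Classical in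
/-- The partial Cartan matrix: `2` on the diagonal, `-1` on solid edges, `1` on dotted edges,
`0` elsewhere. It is the Gram matrix of every set of roots represented by the diagram. -/
def partialCartan (u v : V) : ℤ :=
  if u = v then 2 else if Γ.solid.Adj u v then -1 else if Γ.dotted.Adj u v then 1 else 0

lemma partialCartan_self (u : V) : Γ.partialCartan u u = 2 := by
  simp [partialCartan]

/-- A simply-laced root system in a Euclidean space, normalized so that every root has squared
length `2` and is its own coroot; `(root i, root j)` is then the usual Cartan integer. -/
structure _root_.IsNormalizedSimplyLaced {ι : Type} {n : ℕ}
    (P : RootPairing ι ℝ (EuclideanSpace ℝ (Fin n)) (EuclideanSpace ℝ (Fin n))) : Prop where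
  rootSystem : P.IsRootSystem
  crystallographic : P.IsCrystallographic
  toLinearMap_eq : ∀ x y, P.toLinearMap x y = inner ℝ x y
  coroot_eq : ∀ i, P.coroot i = P.root i

/-- `x` is a linkage labels vector (equivalently, the vector of a linkage diagram) for `Γ`:
it is nonzero, and in some simply-laced root system there are linearly independent roots `root (s v)`
forming the diagram `Γ`, and a further root `γ = root g`, linearly independent of them, such that
`x v = (γ, root (s v))` for all vertices `v`. -/
def IsLinkageLabels (x : V → ℤ) : Prop :=
  x ≠ 0 ∧
  ∃ (ι : Type) (_ : Finite ι) (n : ℕ)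
    (P : RootPairing ι ℝ (EuclideanSpace ℝ (Fin n)) (EuclideanSpace ℝ (Fin n)))
    (s : V → ι) (g : ι),
    IsNormalizedSimplyLaced P ∧
    LinearIndependent ℝ (fun v => P.root (s v)) ∧
    (∀ u v, inner ℝ (P.root (s u)) (P.root (s v)) = (Γ.partialCartan u v : ℝ)) ∧
    P.root g ∉ Submodule.span ℝ (Set.range fun v => P.root (s v)) ∧
    ∀ v, inner ℝ (P.root g) (P.root (s v)) = (x v : ℝ)

/-- The dual reflection attached to a vertex `u`: `(s x) v = x v - x u * B u v`. It describes how
the labels `(γ, τ v)` change when `γ` is reflected in the root `τ u`. -/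
def dualReflection (u : V) : (V → ℤ) ≃ₗ[ℤ] (V → ℤ) :=
  Module.reflection (x := Γ.partialCartan u) (f := LinearMap.proj u)
    (by rw [LinearMap.proj_apply, partialCartan_self])

lemma dualReflection_apply (u v : V) (x : V → ℤ) :
    Γ.dualReflection u x v = x v - x u * Γ.partialCartan u v := by
  rw [dualReflection, Module.reflection_apply]
  simp

/-- The dual partial Weyl group. -/
def dualPartialWeylGroup : Subgroup ((V → ℤ) ≃ₗ[ℤ] (V → ℤ)) :=
  Subgroup.closure (Set.range Γ.dualReflection)

/-- Edges of the linkage system of `Γ`: its nodes are the linkage labels vectors, and two distinct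
nodes `x`, `y` are joined by an edge marked `u` if the dual reflection of `u` exchanges them. -/
def LinkageEdge (u : V) (x y : V → ℤ) : Prop :=
  Γ.IsLinkageLabels x ∧ Γ.IsLinkageLabels y ∧ x ≠ y ∧ Γ.dualReflection u x = y

end SignedDiagram

/-! ### The diagrams `D_l(a_k)` and `D_l` -/

/-- Vertices of a diagram with two tails: `tau 0` is `β₁`, and `tau i` is `τ_i` for `i ≥ 1`;
`phi 0` is `β₂`, and `phi i` is `φ_i` for `i ≥ 1`. -/
inductive TailVertex (p q : ℕ) : Type
  | alpha2
  | alpha3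
  | tau (i : Fin p)
  | phi (i : Fin q)

namespace TailVertex

variable {p q : ℕ}

/-- Solid edges, each listed in one direction. -/
inductive SolidStep : TailVertex p q → TailVertex p q → Prop
  | tauTail (i j : Fin p) (h : (i : ℕ) + 1 = j) : SolidStep (tau i) (tau j)
  | phiTail (i j : Fin q) (h : (i : ℕ) + 1 = j) : SolidStep (phi i) (phi j)
  | alpha2_beta1 (i : Fin p) (h : (i : ℕ) = 0) : SolidStep alpha2 (tau i)
  | alpha3_beta1 (i : Fin p) (h : (i : ℕ) = 0) : SolidStep alpha3 (tau i)
  | alpha2_beta2 (i : Fin q) (h : (i : ℕ) = 0) : SolidStep alpha2 (phi i)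

/-- The dotted edge, listed in one direction. -/
inductive DottedStep : TailVertex p q → TailVertex p q → Prop
  | alpha3_beta2 (i : Fin q) (h : (i : ℕ) = 0) : DottedStep alpha3 (phi i)

end TailVertex

/-- The chain `tau 0 - tau 1 - ⋯` of `p` vertices and the chain `phi 0 - phi 1 - ⋯` of `q` vertices,
whose first vertices are both joined to `α₂` and to `α₃`, the edge `α₃ - phi 0` being dotted. -/
def twoTailDiagram (p q : ℕ) : SignedDiagram (TailVertex p q) where
  solid := SimpleGraph.fromRel TailVertex.SolidStep
  dotted := SimpleGraph.fromRel TailVertex.DottedStep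
  disjoint := by
    rw [disjoint_iff_inf_le]
    intro a b h
    obtain ⟨⟨_, h1⟩, ⟨_, h2⟩⟩ := h
    rcases h1 with h1 | h1 <;> rcases h2 with h2 | h2 <;> cases h2 <;> cases h1

/-- The Carter diagram `D_l(a_k)`, `1 ≤ k ≤ l - 3`: the `4`-cycle `β₁, α₂, β₂, α₃` with the tails
`τ_1, …, τ_{k-1}` at `β₁` and `φ_1, …, φ_{l-k-3}` at `β₂`. -/
abbrev carterD (l k : ℕ) : SignedDiagram (TailVertex k (l - k - 2)) := twoTailDiagram k (l - k - 2)

/-- The Dynkin diagram `D_l`, with branch vertex `β₁`, short arms `α₂`, `α₃` and long arm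
`τ_1, …, τ_{l-3}`. -/
abbrev dynkinD (l : ℕ) : SignedDiagram (TailVertex (l - 2) 0) := twoTailDiagram (l - 2) 0

/-! ### The wind rose -/

/-- Nodes of the wind rose with four arms: two arms with `p + 1` nodes and two arms with `q + 1`
nodes, numbered outwards from the centre and told apart by a sign. -/
inductive WindRose (p q : ℕ) : Type
  | tau (ε : ℤˣ) (j : Fin (p + 1))
  | phi (ε : ℤˣ) (j : Fin (q + 1))

namespace WindRose

variable {p q : ℕ}

/-- The linkage diagram placed at a node of the wind rose. -/
def labels : WindRose p q → TailVertex p q → ℤ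
  | tau ε j, v => ε * match v with
    | .alpha2 => if (j : ℕ) = 0 then 1 else 0
    | .alpha3 => if (j : ℕ) = 0 then 1 else 0
    | .tau i => (if (i : ℕ) + 1 = j then 1 else 0) - (if (i : ℕ) = j then 1 else 0)
    | .phi _ => 0
  | phi ε j, v => ε * match v with
    | .alpha2 => if (j : ℕ) = 0 then -1 else 0
    | .alpha3 => if (j : ℕ) = 0 then 1 else 0
    | .tau _ => 0
    | .phi i => (if (i : ℕ) = j then 1 else 0) - (if (i : ℕ) + 1 = j then 1 else 0)

/-- Marked edges of the wind rose, each listed in one direction: the `j`-th edge of an arm carries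
the mark `tau j` (resp. `phi j`), and the four inner nodes form a square with marks `α₂`, `α₃`. -/
inductive Step : TailVertex p q → WindRose p q → WindRose p q → Prop
  | tauArm (ε : ℤˣ) (j : Fin p) : Step (.tau j) (tau ε j.castSucc) (tau ε j.succ)
  | phiArm (ε : ℤˣ) (j : Fin q) : Step (.phi j) (phi ε j.castSucc) (phi ε j.succ)
  | square2 (ε : ℤˣ) : Step .alpha2 (tau ε 0) (phi ε 0)
  | square3 (ε : ℤˣ) : Step .alpha3 (tau ε 0) (phi (-ε) 0)

/-- Two nodes of the wind rose are joined by an edge with the given mark. -/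
def Edge (v : TailVertex p q) (a b : WindRose p q) : Prop :=
  Step v a b ∨ Step v b a

end WindRose

/-- The linkage diagrams of `Γ` are exactly those at the nodes of the wind rose, without repetition,
the edges of the linkage system with their marks are those of the wind rose, and the linkage system
is a single orbit of the dual partial Weyl group. -/
structure LinkageSystemIsWindRose {p q : ℕ} (Γ : SignedDiagram (TailVertex p q)) : Prop where
  injective : Function.Injective (WindRose.labels (p := p) (q := q))
  complete : {x | Γ.IsLinkageLabels x} = Set.range (WindRose.labels (p := p) (q := q))
  edges : ∀ (v : TailVertex p q) (a b : WindRose p q),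
    Γ.LinkageEdge v a.labels b.labels ↔ WindRose.Edge v a b
  transitive : ∀ a b : WindRose p q, ∃ w ∈ Γ.dualPartialWeylGroup, w a.labels = b.labels

open Classical in
/-- The labels vector with the entry `c` at the vertex `v` and zeros elsewhere. -/
def unitLabels {V : Type} (v : V) (c : ℤ) : V → ℤ := Pi.single v c

end

/-!
The two-tail diagram with `p + q = l - 2` is realized by roots of the lattice `D_l` inside `ℝˡ`: with
an orthonormal basis `e_0, …, e_p, f_0, …, f_q`, put `τ_i = e_{i+1} - e_i`, `φ_i = f_i - f_{i+1}`,
`α₂ = e_0 - f_0` and `α₃ = e_0 + f_0`. The labels at the nodes `T_j`, `F_j` of the wind rose are the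
inner products with `e_j`, `f_j` (`inner_vertexRoot`); equivalently, each row of the partial Cartan
matrix is a sum or difference of two such labels vectors (`partialCartan_tau` and its companions).
Therefore the dual reflections act on the nodes as the reflections of `D_l` act on the signed basis
vectors, which gives the edges (`edge_iff_dualReflection`) and the single orbit
(`exists_dualPartialWeylGroup_labels`).

Every node is a linkage labels vector (`isLinkageLabels_labels`): take for `γ` the root `± e_a + e`
of `D_{l+1}`, where `e` is the additional basis vector.

Conversely, in any realization the basis is recovered from the vertices by an integral recursion, up
to the factor `2` (`doubledFrame`), and the Gram matrix makes the recovered frame orthogonal. If a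
root `γ` of squared length `2` is not in the span of the diagram, then its projection to the span has
squared length less than `2` (`sum_sq_doubledFrame_lt`). Its coordinates are all integers or all
half-integers (`two_dvd_doubledFrame_sub`). Half-integers would give squared length at least
`l / 4`, which is at least `2` as soon as `l > 7`; integers force exactly one coordinate `± 1`, so the
labels vector is a node of the wind rose (`mem_range_labels_of_sum_sq_lt`).
-/

open TailVertex WindRose

variable {p q : ℕ}

/-! ### Nodes of the wind rose as signed coordinate axes -/

namespace WindRose

/-- The labels vector at the positive node number `j` of an arm pair. The nodes of the wind rose
are `± axisLabels a`, where `a` runs over the `p + q + 2` coordinate axes. -/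
def axisLabels : Fin (p + 1) ⊕ Fin (q + 1) → TailVertex p q → ℤ
  | .inl j => labels (tau 1 j)
  | .inr j => labels (phi 1 j)

/-- The node with sign `ε` on the axis `a`. -/
def ofAxis (ε : ℤˣ) : Fin (p + 1) ⊕ Fin (q + 1) → WindRose p q
  | .inl j => tau ε j
  | .inr j => phi ε j

lemma exists_ofAxis (a : WindRose p q) : ∃ ε b, a = ofAxis ε b := by
  cases a with
  | tau ε j => exact ⟨ε, .inl j, rfl⟩
  | phi ε j => exact ⟨ε, .inr j, rfl⟩

lemma labels_ofAxis (ε : ℤˣ) (a : Fin (p + 1) ⊕ Fin (q + 1)) (v : TailVertex p q) :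
    labels (ofAxis ε a) v = ε * axisLabels a v := by
  cases a <;> simp [ofAxis, axisLabels, labels]

end WindRose

/-! ### Rows of the partial Cartan matrix -/

lemma TailVertex.solidStep_iff (u v : TailVertex p q) :
    SolidStep u v ↔ match u, v with
      | .tau i, .tau j => (i : ℕ) + 1 = j
      | .phi i, .phi j => (i : ℕ) + 1 = j
      | .alpha2, .tau i => (i : ℕ) = 0
      | .alpha3, .tau i => (i : ℕ) = 0
      | .alpha2, .phi i => (i : ℕ) = 0
      | _, _ => False := by
  constructor
  · intro h
    cases h <;> assumption
  · cases u <;> cases v <;> intro h <;> first | exact h.elim | constructor; exact h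

lemma TailVertex.dottedStep_iff (u v : TailVertex p q) :
    DottedStep u v ↔ match u, v with
      | .alpha3, .phi i => (i : ℕ) = 0
      | _, _ => False := by
  constructor
  · intro h
    cases h; assumption
  · cases u <;> cases v <;> intro h <;> first | exact h.elim | constructor; exact h

lemma partialCartan_tau (i : Fin p) (v : TailVertex p q) :
    (twoTailDiagram p q).partialCartan (.tau i) v =
      axisLabels (.inl i.succ) v - axisLabels (.inl i.castSucc) v := by
  cases v <;>
    simp [SignedDiagram.partialCartan, twoTailDiagram, solidStep_iff, dottedStep_iff, axisLabels,
      labels, Fin.ext_iff]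
  all_goals grind

lemma partialCartan_phi (i : Fin q) (v : TailVertex p q) :
    (twoTailDiagram p q).partialCartan (.phi i) v =
      axisLabels (.inr i.castSucc) v - axisLabels (.inr i.succ) v := by
  cases v <;>
    simp [SignedDiagram.partialCartan, twoTailDiagram, solidStep_iff, dottedStep_iff, axisLabels,
      labels, Fin.ext_iff]
  all_goals grind

lemma partialCartan_alpha2 (v : TailVertex p q) :
    (twoTailDiagram p q).partialCartan .alpha2 v =
      axisLabels (.inl 0) v - axisLabels (.inr 0) v := by
  cases v <;>
    simp [SignedDiagram.partialCartan, twoTailDiagram, solidStep_iff, dottedStep_iff, axisLabels,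
      labels]
  all_goals grind

lemma partialCartan_alpha3 (v : TailVertex p q) :
    (twoTailDiagram p q).partialCartan .alpha3 v =
      axisLabels (.inl 0) v + axisLabels (.inr 0) v := by
  cases v <;>
    simp [SignedDiagram.partialCartan, twoTailDiagram, solidStep_iff, dottedStep_iff, axisLabels,
      labels]
  all_goals grind

/-! ### The orthogonal frame attached to the diagram -/

section Frame

variable {M N : Type*} [AddCommGroup M] [AddCommGroup N]

/-- Twice the coordinate frame recovered from vectors placed at the vertices: when
`x tau_i = e_{i+1} - e_i`, `x phi_i = f_i - f_{i+1}`, `x α₂ = e_0 - f_0` and `x α₃ = e_0 + f_0`,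
this is the family of all `2 e_j` and `2 f_j`. The factor `2` keeps it defined over `ℤ`. -/
def doubledFrame (x : TailVertex p q → M) : Fin (p + 1) ⊕ Fin (q + 1) → M
  | .inl j => x .alpha2 + x .alpha3 + Fin.partialSum (fun i => 2 • x (.tau i)) j
  | .inr j => x .alpha3 - x .alpha2 - Fin.partialSum (fun i => 2 • x (.phi i)) j

variable (x : TailVertex p q → M)

lemma doubledFrame_inl_zero : doubledFrame x (.inl 0) = x .alpha2 + x .alpha3 := by
  simp [doubledFrame]

lemma doubledFrame_inr_zero : doubledFrame x (.inr 0) = x .alpha3 - x .alpha2 := by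
  simp [doubledFrame]

lemma doubledFrame_inl_succ (i : Fin p) :
    doubledFrame x (.inl i.succ) = doubledFrame x (.inl i.castSucc) + 2 • x (.tau i) := by
  simp [doubledFrame, Fin.partialSum_succ, add_assoc]

lemma doubledFrame_inr_succ (i : Fin q) :
    doubledFrame x (.inr i.succ) = doubledFrame x (.inr i.castSucc) - 2 • x (.phi i) := by
  simp only [doubledFrame, Fin.partialSum_succ]
  abel

/-- The recursion along the two tails determines the doubled frame. -/
lemma eq_doubledFrame (y : Fin (p + 1) ⊕ Fin (q + 1) → M)
    (hl : y (.inl 0) = x .alpha2 + x .alpha3) (hr : y (.inr 0) = x .alpha3 - x .alpha2)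
    (hls : ∀ i : Fin p, y (.inl i.succ) = y (.inl i.castSucc) + 2 • x (.tau i))
    (hrs : ∀ i : Fin q, y (.inr i.succ) = y (.inr i.castSucc) - 2 • x (.phi i)) :
    doubledFrame x = y := by
  funext a
  rcases a with j | j
  · induction j using Fin.induction with
    | zero => rw [doubledFrame_inl_zero, hl]
    | succ i ih => rw [doubledFrame_inl_succ, hls, ih]
  · induction j using Fin.induction with
    | zero => rw [doubledFrame_inr_zero, hr]
    | succ i ih => rw [doubledFrame_inr_succ, hrs, ih]

lemma doubledFrame_zero : doubledFrame (0 : TailVertex p q → M) = 0 :=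
  eq_doubledFrame _ _ (by simp) (by simp) (by simp) (by simp)

lemma map_doubledFrame (f : M →+ N) (a : Fin (p + 1) ⊕ Fin (q + 1)) :
    f (doubledFrame x a) = doubledFrame (fun v => f (x v)) a := by
  symm
  refine congrFun (eq_doubledFrame _ (fun a => f (doubledFrame x a)) ?_ ?_ ?_ ?_) a
  · simp [doubledFrame_inl_zero]
  · simp [doubledFrame_inr_zero]
  · simp [doubledFrame_inl_succ]
  · simp [doubledFrame_inr_succ]

end Frame

/-- The frame of the Gram matrix is twice the labels at the positive nodes: in any realization of
the diagram, `v` has the coordinates `axisLabels a v` in the frame `doubledFrame / 2`. -/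
lemma doubledFrame_partialCartan (v : TailVertex p q) (a : Fin (p + 1) ⊕ Fin (q + 1)) :
    doubledFrame (fun u => (twoTailDiagram p q).partialCartan u v) a = 2 * axisLabels a v := by
  refine congrFun (eq_doubledFrame _ (fun a => 2 * axisLabels a v) ?_ ?_ ?_ ?_) a
  · simp only [partialCartan_alpha2, partialCartan_alpha3]; ring
  · simp only [partialCartan_alpha2, partialCartan_alpha3]; ring
  · intro i
    simp only [partialCartan_tau, nsmul_eq_mul]; push_cast; ring
  · intro i
    simp only [partialCartan_phi, nsmul_eq_mul]; push_cast; ring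

/-- The labels at the positive nodes are the coordinate functionals of the frame. -/
lemma doubledFrame_axisLabels (a b : Fin (p + 1) ⊕ Fin (q + 1)) :
    doubledFrame (axisLabels a) b = if a = b then 2 else 0 := by
  refine congrFun (eq_doubledFrame _ (fun b => if a = b then 2 else 0) ?_ ?_ ?_ ?_) b
  all_goals
    rcases a with j | j
    all_goals
      simp only [axisLabels, labels, Sum.inl.injEq, Sum.inr.injEq, reduceCtorEq, Fin.ext_iff,
        Fin.val_succ, Fin.val_castSucc, Fin.val_zero, Units.val_one, nsmul_eq_mul]
      try intro i
      grind

lemma doubledFrame_injective :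
    Function.Injective (doubledFrame : (TailVertex p q → ℤ) → _ → ℤ) := by
  intro x y h
  have hl0 := congrFun h (.inl 0)
  have hr0 := congrFun h (.inr 0)
  simp only [doubledFrame_inl_zero, doubledFrame_inr_zero] at hl0 hr0
  funext v
  cases v with
  | alpha2 => lia
  | alpha3 => lia
  | tau i =>
    have h1 := congrFun h (.inl i.succ)
    simp only [doubledFrame_inl_succ, congrFun h (.inl i.castSucc), nsmul_eq_mul] at h1
    lia
  | phi i =>
    have h1 := congrFun h (.inr i.succ)
    simp only [doubledFrame_inr_succ, congrFun h (.inr i.castSucc), nsmul_eq_mul] at h1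
    lia

lemma doubledFrame_labels (ε : ℤˣ) (a b : Fin (p + 1) ⊕ Fin (q + 1)) :
    doubledFrame (ofAxis ε a).labels b = if a = b then 2 * (ε : ℤ) else 0 := by
  have := map_doubledFrame (axisLabels a) (AddMonoidHom.mulLeft (ε : ℤ)) b
  simp only [AddMonoidHom.coe_mulLeft, ← labels_ofAxis, doubledFrame_axisLabels] at this
  rw [← this]
  split_ifs <;> ring

lemma labels_injective : Function.Injective (labels (p := p) (q := q)) := by
  intro a b h
  obtain ⟨ε, a, rfl⟩ := exists_ofAxis a
  obtain ⟨δ, b, rfl⟩ := exists_ofAxis b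
  have h1 := doubledFrame_labels ε a a
  rw [h, doubledFrame_labels] at h1
  have hne := ε.ne_zero
  by_cases hab : b = a
  · subst hab
    have : δ = ε := Units.ext (by simpa using h1)
    rw [this]
  · simp [hab] at h1

lemma labels_ne_zero (a : WindRose p q) : a.labels ≠ 0 := by
  obtain ⟨ε, a, rfl⟩ := exists_ofAxis a
  intro h
  have h1 := doubledFrame_labels ε a a
  rw [h, doubledFrame_zero] at h1
  simp at h1

/-- The coordinates of a labels vector in the orthonormal frame are all integers or all
half-integers. -/
lemma two_dvd_doubledFrame_sub (x : TailVertex p q → ℤ) (a b : Fin (p + 1) ⊕ Fin (q + 1)) :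
    2 ∣ doubledFrame x a - doubledFrame x b := by
  suffices h : ∀ a, 2 ∣ doubledFrame x a - doubledFrame x (.inl 0) by
    have := h a
    have := h b
    lia
  intro a
  rcases a with j | j
  · induction j using Fin.induction with
    | zero => simp
    | succ i ih =>
      simp only [doubledFrame_inl_succ, nsmul_eq_mul]
      push_cast
      lia
  · induction j using Fin.induction with
    | zero =>
      simp only [doubledFrame_inr_zero, doubledFrame_inl_zero]
      lia
    | succ i ih =>
      simp only [doubledFrame_inr_succ, nsmul_eq_mul]
      push_cast
      lia

/-! ### The dual reflections permute the nodes of the wind rose -/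

lemma dualReflection_labels_of_step {v : TailVertex p q} {a b : WindRose p q} (h : Step v a b) :
    (twoTailDiagram p q).dualReflection v a.labels = b.labels := by
  funext w
  rw [SignedDiagram.dualReflection_apply]
  cases h with
  | tauArm ε j =>
    change labels (ofAxis ε (.inl j.castSucc)) w - labels (ofAxis ε (.inl j.castSucc)) _ * _ =
      labels (ofAxis ε (.inl j.succ)) w
    rw [partialCartan_tau]
    simp only [labels_ofAxis]
    have : axisLabels (.inl j.castSucc) (.tau j : TailVertex p q) = -1 := by
      simp [axisLabels, labels]
    rw [this]; ring
  | phiArm ε j =>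
    change labels (ofAxis ε (.inr j.castSucc)) w - labels (ofAxis ε (.inr j.castSucc)) _ * _ =
      labels (ofAxis ε (.inr j.succ)) w
    rw [partialCartan_phi]
    simp only [labels_ofAxis]
    have : axisLabels (.inr j.castSucc) (.phi j : TailVertex p q) = 1 := by
      simp [axisLabels, labels]
    rw [this]; ring
  | square2 ε =>
    change labels (ofAxis ε (.inl 0)) w - labels (ofAxis ε (.inl 0)) _ * _ =
      labels (ofAxis ε (.inr 0)) w
    rw [partialCartan_alpha2]
    simp only [labels_ofAxis]
    have : axisLabels (.inl 0) (.alpha2 : TailVertex p q) = 1 := by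
      simp [axisLabels, labels]
    rw [this]; ring
  | square3 ε =>
    change labels (ofAxis ε (.inl 0)) w - labels (ofAxis ε (.inl 0)) _ * _ =
      labels (ofAxis (-ε) (.inr 0)) w
    rw [partialCartan_alpha3]
    simp only [labels_ofAxis]
    have : axisLabels (.inl 0) (.alpha3 : TailVertex p q) = 1 := by
      simp [axisLabels, labels]
    rw [this]; push_cast; ring

lemma SignedDiagram.dualReflection_dualReflection {V : Type} (Γ : SignedDiagram V) (u : V)
    (x : V → ℤ) : Γ.dualReflection u (Γ.dualReflection u x) = x := by
  funext v
  simp only [dualReflection_apply, partialCartan_self]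
  ring

lemma dualReflection_labels_of_edge {v : TailVertex p q} {a b : WindRose p q} (h : Edge v a b) :
    (twoTailDiagram p q).dualReflection v a.labels = b.labels := by
  rcases h with h | h
  · exact dualReflection_labels_of_step h
  · rw [← dualReflection_labels_of_step h, SignedDiagram.dualReflection_dualReflection]

/-- Every node whose label at `v` is nonzero lies on an edge of the wind rose marked `v`. -/
lemma exists_edge_of_labels_ne_zero {v : TailVertex p q} {a : WindRose p q}
    (h : a.labels v ≠ 0) : ∃ b, Edge v a b := by
  cases a with
  | tau ε j =>
    cases v with
    | alpha2 =>
      obtain rfl : j = 0 := by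
        by_contra hj
        exact h (by simp [labels, hj])
      exact ⟨_, .inl (.square2 ε)⟩
    | alpha3 =>
      obtain rfl : j = 0 := by
        by_contra hj
        exact h (by simp [labels, hj])
      exact ⟨_, .inl (.square3 ε)⟩
    | tau i =>
      by_cases h1 : (i : ℕ) + 1 = j
      · obtain rfl : j = i.succ := Fin.ext h1.symm
        exact ⟨_, .inr (.tauArm ε i)⟩
      by_cases h2 : (i : ℕ) = j
      · obtain rfl : j = i.castSucc := Fin.ext h2.symm
        exact ⟨_, .inl (.tauArm ε i)⟩
      exact absurd (by simp [labels, h1, h2]) h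
    | phi i => exact absurd (by simp [labels]) h
  | phi ε j =>
    cases v with
    | alpha2 =>
      obtain rfl : j = 0 := by
        by_contra hj
        exact h (by simp [labels, hj])
      exact ⟨_, .inr (.square2 ε)⟩
    | alpha3 =>
      obtain rfl : j = 0 := by
        by_contra hj
        exact h (by simp [labels, hj])
      refine ⟨.tau (-ε) 0, .inr ?_⟩
      simpa using Step.square3 (p := p) (q := q) (-ε)
    | tau i => exact absurd (by simp [labels]) h
    | phi i =>
      by_cases h1 : (i : ℕ) + 1 = j
      · obtain rfl : j = i.succ := Fin.ext h1.symm
        exact ⟨_, .inr (.phiArm ε i)⟩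
      by_cases h2 : (i : ℕ) = j
      · obtain rfl : j = i.castSucc := Fin.ext h2.symm
        exact ⟨_, .inl (.phiArm ε i)⟩
      exact absurd (by simp [labels, h1, h2]) h

lemma WindRose.Edge.ne {v : TailVertex p q} {a b : WindRose p q} (h : Edge v a b) : a ≠ b := by
  rcases h with h | h <;> cases h <;> simp [Fin.ext_iff]

/-- A dual reflection moves a node exactly along the edge with its mark: a reflection fixes every
vector with vanishing label at its vertex, and every other node lies on such an edge. -/
lemma edge_iff_dualReflection {v : TailVertex p q} {a b : WindRose p q} :
    Edge v a b ↔ a ≠ b ∧ (twoTailDiagram p q).dualReflection v a.labels = b.labels := by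
  refine ⟨fun h => ⟨h.ne, dualReflection_labels_of_edge h⟩, fun ⟨hne, h⟩ => ?_⟩
  have hv : a.labels v ≠ 0 := by
    intro hv
    refine hne (labels_injective ?_)
    rw [← h]
    funext w
    simp [SignedDiagram.dualReflection_apply, hv]
  obtain ⟨c, hc⟩ := exists_edge_of_labels_ne_zero hv
  obtain rfl : c = b := labels_injective ((dualReflection_labels_of_edge hc).symm.trans h)
  exact hc

/-- Every node can be moved along the arms and the inner square to a fixed one. -/
lemma exists_dualPartialWeylGroup_labels (a b : WindRose p q) :
    ∃ w ∈ (twoTailDiagram p q).dualPartialWeylGroup, w a.labels = b.labels := by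
  let R (a b : WindRose p q) : Prop :=
    ∃ w ∈ (twoTailDiagram p q).dualPartialWeylGroup, w a.labels = b.labels
  have symm {a b} : R a b → R b a := fun ⟨w, hw, h⟩ =>
    ⟨w⁻¹, inv_mem hw, by rw [← h]; exact w.symm_apply_apply _⟩
  have trans {a b c} : R a b → R b c → R a c := fun ⟨w, hw, h⟩ ⟨w', hw', h'⟩ =>
    ⟨w' * w, mul_mem hw' hw, by rw [← h', ← h]; rfl⟩
  have step {v a b} (h : Step v a b) : R a b :=
    ⟨_, Subgroup.subset_closure ⟨v, rfl⟩, dualReflection_labels_of_step h⟩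
  have arm_tau (ε : ℤˣ) (j : Fin (p + 1)) : R (tau ε 0) (tau ε j) := by
    induction j using Fin.induction with
    | zero => exact ⟨1, one_mem _, rfl⟩
    | succ i ih => exact trans ih (step (.tauArm ε i))
  have arm_phi (ε : ℤˣ) (j : Fin (q + 1)) : R (phi ε 0) (phi ε j) := by
    induction j using Fin.induction with
    | zero => exact ⟨1, one_mem _, rfl⟩
    | succ i ih => exact trans ih (step (.phiArm ε i))
  have opp : R (tau 1 0) (tau (-1) 0) :=
    trans (step (.square2 1)) (symm (by simpa using step (.square3 (p := p) (q := q) (-1))))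
  have centre (ε : ℤˣ) : R (tau 1 0) (tau ε 0) := by
    rcases Int.units_eq_one_or ε with rfl | rfl
    · exact arm_tau 1 0
    · exact opp
  have all (a : WindRose p q) : R (tau 1 0) a := by
    cases a with
    | tau ε j => exact trans (centre ε) (arm_tau ε j)
    | phi ε j => exact trans (trans (centre ε) (step (.square2 ε))) (arm_phi ε j)
  exact trans (symm (all a)) (all b)

/-! ### The root system of type `D` -/

/-- The vectors with integer coordinates and squared length `2`, that is, `± e_i ± e_j` for `i ≠ j`:
the roots of type `D_n`. -/
def integralRoots (n : ℕ) : Set (EuclideanSpace ℝ (Fin n)) :=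
  {v | (∀ i, ∃ z : ℤ, v i = z) ∧ inner ℝ v v = 2}

variable {n : ℕ}

lemma finite_integralRoots (n : ℕ) : (integralRoots n).Finite := by
  let f : (Fin n → ℤ) → EuclideanSpace ℝ (Fin n) := fun z => WithLp.toLp 2 fun i => (z i : ℝ)
  refine ((Set.finite_Icc (fun _ => -2 : Fin n → ℤ) (fun _ => 2)).image f).subset ?_
  rintro v ⟨hv, hv2⟩
  choose z hz using hv
  replace hz : ∀ i, v i = (z i : ℝ) := hz
  have hle (i : Fin n) : z i ^ 2 ≤ 2 := by
    have h1 : (v i) ^ 2 ≤ inner ℝ v v := by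
      rw [real_inner_self_eq_norm_sq, EuclideanSpace.real_norm_sq_eq]
      exact Finset.single_le_sum (f := fun i => v i ^ 2) (fun i _ => sq_nonneg _)
        (Finset.mem_univ i)
    rw [hv2, hz i] at h1
    have h2 : ((z i ^ 2 : ℤ) : ℝ) ≤ ((2 : ℤ) : ℝ) := by push_cast; exact h1
    exact Int.cast_le.1 h2
  refine ⟨z, ⟨fun i => ?_, fun i => ?_⟩, ?_⟩
  · have := hle i
    simp only
    nlinarith
  · have := hle i
    simp only
    nlinarith
  · ext i
    simp [f, hz]

lemma exists_int_inner_of_mem {v w : EuclideanSpace ℝ (Fin n)} (hv : v ∈ integralRoots n)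
    (hw : w ∈ integralRoots n) : ∃ z : ℤ, inner ℝ v w = z := by
  choose a ha using hv.1
  choose b hb using hw.1
  refine ⟨∑ i, b i * a i, ?_⟩
  rw [PiLp.inner_apply]
  simp [ha, hb, mul_comm]

lemma reflection_mem_integralRoots {v w : EuclideanSpace ℝ (Fin n)} (hv : v ∈ integralRoots n)
    (hw : w ∈ integralRoots n) : v - inner ℝ v w • w ∈ integralRoots n := by
  obtain ⟨c, hc⟩ := exists_int_inner_of_mem hv hw
  refine ⟨fun i => ?_, ?_⟩
  · obtain ⟨a, ha⟩ := hv.1 i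
    obtain ⟨b, hb⟩ := hw.1 i
    exact ⟨a - c * b, by simp [hc, ha, hb]⟩
  · simp only [inner_sub_left, inner_sub_right, inner_smul_left, inner_smul_right, hv.2, hw.2,
      real_inner_comm v w, conj_trivial]
    ring

instance isPerfPair_innerₗ : (innerₗ (EuclideanSpace ℝ (Fin n))).IsPerfPair := by
  refine .of_injective ?_ ?_
  · exact (injective_iff_map_eq_zero _).2 fun v hv =>
      inner_self_eq_zero.1 (LinearMap.congr_fun hv v)
  · rw [flip_innerₗ]
    exact (injective_iff_map_eq_zero _).2 fun v hv =>
      inner_self_eq_zero.1 (LinearMap.congr_fun hv v)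

/-- The root system `D_n` in `ℝⁿ`, every root being its own coroot. -/
noncomputable def integralRootPairing (n : ℕ) :
    RootPairing (integralRoots n) ℝ (EuclideanSpace ℝ (Fin n)) (EuclideanSpace ℝ (Fin n)) where
  toLinearMap := innerₗ _
  root := .subtype _
  coroot := .subtype _
  root_coroot_two v := v.2.2
  reflectionPerm w := Function.Involutive.toPerm
    (fun v => ⟨v.1 - inner ℝ v.1 w.1 • w.1, reflection_mem_integralRoots v.2 w.2⟩) fun v => by
      ext1
      simp only [inner_sub_left, inner_smul_left, w.2.2, conj_trivial]
      module
  reflectionPerm_root _ _ := rfl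
  reflectionPerm_coroot w v := by
    change v.1 - inner ℝ w.1 v.1 • w.1 = v.1 - inner ℝ v.1 w.1 • w.1
    rw [real_inner_comm]

lemma single_add_single_mem {i j : Fin n} (hij : i ≠ j) (ε δ : ℤˣ) :
    EuclideanSpace.single i ((ε : ℤ) : ℝ) + EuclideanSpace.single j ((δ : ℤ) : ℝ) ∈
      integralRoots n := by
  have hε : ((ε : ℤ) : ℝ) * ((ε : ℤ) : ℝ) = 1 := by
    rcases Int.units_eq_one_or ε with rfl | rfl <;> simp
  have hδ : ((δ : ℤ) : ℝ) * ((δ : ℤ) : ℝ) = 1 := by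
    rcases Int.units_eq_one_or δ with rfl | rfl <;> simp
  refine ⟨fun k => ⟨(if k = i then (ε : ℤ) else 0) + (if k = j then (δ : ℤ) else 0), ?_⟩, ?_⟩
  · simp
  · simp only [inner_add_left, inner_add_right, EuclideanSpace.inner_single_left]
    simp [hij, hij.symm, hε, hδ]
    norm_num

lemma single_sub_single_mem {i j : Fin n} (hij : i ≠ j) :
    EuclideanSpace.single i (1 : ℝ) - EuclideanSpace.single j 1 ∈ integralRoots n := by
  have := single_add_single_mem hij 1 (-1)
  convert this using 1
  ext k
  simp
  split_ifs <;> norm_num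

lemma span_integralRoots (hn : 2 ≤ n) : Submodule.span ℝ (integralRoots n) = ⊤ := by
  have hsingle (i : Fin n) :
      EuclideanSpace.single i (1 : ℝ) ∈ Submodule.span ℝ (integralRoots n) := by
    have : Nontrivial (Fin n) := Fin.nontrivial_iff_two_le.2 hn
    obtain ⟨j, hj⟩ := exists_ne i
    have h1 := Submodule.subset_span (R := ℝ) (single_add_single_mem hj.symm 1 1)
    have h2 := Submodule.subset_span (R := ℝ) (single_add_single_mem hj.symm 1 (-1))
    -- `2 e_i` is the sum of the roots `e_i + e_j` and `e_i - e_j`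
    convert Submodule.smul_mem _ (1 / 2 : ℝ) (Submodule.add_mem _ h1 h2) using 1
    ext k
    simp
    split_ifs <;> norm_num
  rw [← top_le_iff, ← (EuclideanSpace.basisFun (Fin n) ℝ).toBasis.span_eq, Submodule.span_le]
  rintro _ ⟨i, rfl⟩
  simpa using hsingle i

lemma isNormalizedSimplyLaced_integralRootPairing (hn : 2 ≤ n) :
    IsNormalizedSimplyLaced (integralRootPairing n) where
  rootSystem := by
    have h : Submodule.span ℝ (Set.range (Subtype.val : integralRoots n → _)) = ⊤ := by
      rw [Subtype.range_coe, span_integralRoots hn]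
    exact ⟨h, h⟩
  crystallographic := ⟨fun v w => by
    obtain ⟨z, hz⟩ := exists_int_inner_of_mem v.2 w.2
    exact ⟨z, hz.symm⟩⟩
  toLinearMap_eq _ _ := rfl
  coroot_eq _ := rfl

/-! ### Every node of the wind rose is a linkage labels vector -/

/-- The roots at the vertices of the diagram, in the coordinates of an orthonormal family `e`. -/
def vertexRoot {E : Type*} [AddCommGroup E] (e : Fin (p + 1) ⊕ Fin (q + 1) → E) : TailVertex p q → E
  | .alpha2 => e (.inl 0) - e (.inr 0)
  | .alpha3 => e (.inl 0) + e (.inr 0)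
  | .tau i => e (.inl i.succ) - e (.inl i.castSucc)
  | .phi i => e (.inr i.castSucc) - e (.inr i.succ)

lemma doubledFrame_vertexRoot {E : Type*} [AddCommGroup E]
    (e : Fin (p + 1) ⊕ Fin (q + 1) → E) :
    doubledFrame (vertexRoot e) = fun a => (2 : ℕ) • e a := by
  refine eq_doubledFrame _ _ ?_ ?_ ?_ ?_
  · simp only [vertexRoot]; module
  · simp only [vertexRoot]; module
  · intro i; simp only [vertexRoot]; module
  · intro i; simp only [vertexRoot]; module

section Realization

variable {E : Type*} [NormedAddCommGroup E] [InnerProductSpace ℝ E]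

variable {e : Fin (p + 1) ⊕ Fin (q + 1) → E}

lemma inner_vertexRoot (he : Orthonormal ℝ e) (a : Fin (p + 1) ⊕ Fin (q + 1))
    (v : TailVertex p q) : inner ℝ (e a) (vertexRoot e v) = axisLabels a v := by
  have h := orthonormal_iff_ite.1 he
  cases v <;> cases a <;>
    simp only [vertexRoot, inner_add_right, inner_sub_right, h, axisLabels, labels, Fin.ext_iff,
      Sum.inl.injEq, Sum.inr.injEq, reduceCtorEq, Fin.val_succ, Fin.val_castSucc, Fin.val_zero,
      Units.val_one, one_mul, Int.cast_sub, Int.cast_ite, Int.cast_one, Int.cast_zero,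
      Int.cast_neg]
  all_goals grind

lemma inner_vertexRoot_vertexRoot (he : Orthonormal ℝ e) (u v : TailVertex p q) :
    inner ℝ (vertexRoot e u) (vertexRoot e v) = (twoTailDiagram p q).partialCartan u v := by
  cases u <;>
    simp only [partialCartan_alpha2, partialCartan_alpha3, partialCartan_tau, partialCartan_phi] <;>
    conv_lhs => enter [2]; unfold vertexRoot
  all_goals
    simp [inner_sub_left, inner_add_left, inner_vertexRoot he]

end Realization

/-- There are as many vertices as coordinate axes: `α₂` together with the `τ_i` is matched with the
axes `e_j`, and `α₃` together with the `φ_i` with the axes `f_j`. -/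
def vertexEquiv : TailVertex p q ≃ (Unit ⊕ Fin p) ⊕ (Unit ⊕ Fin q) where
  toFun
    | .alpha2 => .inl (.inl ())
    | .alpha3 => .inr (.inl ())
    | .tau i => .inl (.inr i)
    | .phi i => .inr (.inr i)
  invFun
    | .inl (.inl _) => .alpha2
    | .inr (.inl _) => .alpha3
    | .inl (.inr i) => .tau i
    | .inr (.inr i) => .phi i
  left_inv v := by cases v <;> rfl
  right_inv v := by rcases v with (_ | _) | (_ | _) <;> rfl

instance : Fintype (TailVertex p q) := .ofEquiv _ vertexEquiv.symm

lemma card_tailVertex : Fintype.card (TailVertex p q) = (p + 1) + (q + 1) := by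
  rw [Fintype.card_congr vertexEquiv]
  simp
  ring

section Span

variable {E : Type*} [AddCommGroup E] [Module ℝ E]

lemma doubledFrame_mem_span (x : TailVertex p q → E) (a : Fin (p + 1) ⊕ Fin (q + 1)) :
    doubledFrame x a ∈ Submodule.span ℝ (Set.range x) := by
  have hx (v) : x v ∈ Submodule.span ℝ (Set.range x) := Submodule.subset_span ⟨v, rfl⟩
  rcases a with j | j
  · induction j using Fin.induction with
    | zero => rw [doubledFrame_inl_zero]; exact add_mem (hx _) (hx _)
    | succ i ih => rw [doubledFrame_inl_succ]; exact add_mem ih (nsmul_mem (hx _) 2)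
  · induction j using Fin.induction with
    | zero => rw [doubledFrame_inr_zero]; exact sub_mem (hx _) (hx _)
    | succ i ih => rw [doubledFrame_inr_succ]; exact sub_mem ih (nsmul_mem (hx _) 2)

end Span

/-- The vertex roots span as many dimensions as the frame from which they are built. -/
lemma linearIndependent_vertexRoot {E : Type*} [NormedAddCommGroup E] [InnerProductSpace ℝ E]
    {e : Fin (p + 1) ⊕ Fin (q + 1) → E} (he : Orthonormal ℝ e) :
    LinearIndependent ℝ (vertexRoot e) := by
  rw [linearIndependent_iff_card_le_finrank_span, card_tailVertex]
  have h1 := finrank_span_eq_card he.linearIndependent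
  simp only [Fintype.card_sum, Fintype.card_fin] at h1
  rw [← h1]
  have : FiniteDimensional ℝ (Submodule.span ℝ (Set.range (vertexRoot e))) :=
    FiniteDimensional.span_of_finite ℝ (Set.finite_range _)
  refine Submodule.finrank_mono (Submodule.span_le.2 ?_)
  rintro _ ⟨a, rfl⟩
  have h2 := doubledFrame_mem_span (vertexRoot e) a
  rw [doubledFrame_vertexRoot] at h2
  have h3 : e a = (1 / 2 : ℝ) • (2 : ℕ) • e a := by module
  rw [h3]
  exact Submodule.smul_mem _ _ h2

/-- The node is realized in `D_{p+q+3}`: the diagram spans the first `p + q + 2` coordinates, and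
the node `± axisLabels a` is that of the root `± e_a + e`, where `e` is the last unit vector. -/
theorem isLinkageLabels_labels (a : WindRose p q) :
    (twoTailDiagram p q).IsLinkageLabels a.labels := by
  refine ⟨labels_ne_zero a, ?_⟩
  obtain ⟨ε, a, rfl⟩ := exists_ofAxis a
  let n := Fintype.card (Option (Fin (p + 1) ⊕ Fin (q + 1)))
  let t : Option (Fin (p + 1) ⊕ Fin (q + 1)) ≃ Fin n := Fintype.equivFin _
  let e : Fin (p + 1) ⊕ Fin (q + 1) → EuclideanSpace ℝ (Fin n) :=
    fun b => EuclideanSpace.single (t (some b)) 1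
  have he : Orthonormal ℝ e := by
    refine orthonormal_iff_ite.2 fun b c => ?_
    simp [e, EuclideanSpace.inner_single_left]
  have hmem (v : TailVertex p q) : vertexRoot e v ∈ integralRoots n := by
    cases v with
    | alpha2 => exact single_sub_single_mem (by simp)
    | alpha3 => simpa [vertexRoot, e] using
        single_add_single_mem (i := t (some (.inl 0))) (j := t (some (.inr 0))) (by simp) 1 1
    | tau i => exact single_sub_single_mem (by simp [Fin.ext_iff])
    | phi i => exact single_sub_single_mem (by simp [Fin.ext_iff])
  let h : EuclideanSpace ℝ (Fin n) := EuclideanSpace.single (t none) 1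
  have hh (b) : inner ℝ h (e b) = 0 := by simp [h, e, EuclideanSpace.inner_single_left]
  have hhv (v : TailVertex p q) : inner ℝ h (vertexRoot e v) = 0 := by
    cases v <;> simp [vertexRoot, inner_add_right, inner_sub_right, hh]
  let γ : EuclideanSpace ℝ (Fin n) := ((ε : ℤ) : ℝ) • e a + h
  have hγ : γ ∈ integralRoots n := by
    convert single_add_single_mem (i := t (some a)) (j := t none) (by simp) ε 1 using 1
    ext k
    simp [γ, e, h]
  refine ⟨integralRoots n, (finite_integralRoots n).to_subtype, n, integralRootPairing n,
    fun v => ⟨_, hmem v⟩, ⟨γ, hγ⟩, isNormalizedSimplyLaced_integralRootPairing ?_,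
    linearIndependent_vertexRoot he, inner_vertexRoot_vertexRoot he, ?_, fun v => ?_⟩
  · simp only [n, Fintype.card_option, Fintype.card_sum, Fintype.card_fin]
    lia
  · intro hspan
    change γ ∈ Submodule.span ℝ (Set.range (vertexRoot e)) at hspan
    have hle : Submodule.span ℝ (Set.range (vertexRoot e)) ≤ LinearMap.ker (innerₗ _ h) := by
      rw [Submodule.span_le]
      rintro _ ⟨v, rfl⟩
      exact hhv v
    have h0 : inner ℝ h γ = 0 := hle hspan
    simp [γ, inner_add_right, inner_smul_right, hh, h] at h0
  · change inner ℝ γ (vertexRoot e v) = _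
    rw [labels_ofAxis]
    simp [γ, inner_add_left, inner_smul_left, inner_vertexRoot he, hhv]

/-! ### There are no other linkage labels vectors -/

section Projection

variable {E : Type*} [NormedAddCommGroup E] [InnerProductSpace ℝ E]

lemma inner_doubledFrame {s : TailVertex p q → E} {x : TailVertex p q → ℤ} {g : E}
    (hx : ∀ v, inner ℝ g (s v) = x v) (a : Fin (p + 1) ⊕ Fin (q + 1)) :
    inner ℝ g (doubledFrame s a) = doubledFrame x a := by
  have h1 := map_doubledFrame s (innerₗ E g).toAddMonoidHom a
  have h2 := map_doubledFrame x (Int.castAddHom ℝ) a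
  simp only [Int.coe_castAddHom] at h2
  rw [h2]
  simpa [hx] using h1

lemma inner_doubledFrame_doubledFrame {s : TailVertex p q → E}
    (hs : ∀ u v, inner ℝ (s u) (s v) = ((twoTailDiagram p q).partialCartan u v : ℝ))
    (a b : Fin (p + 1) ⊕ Fin (q + 1)) :
    inner ℝ (doubledFrame s a) (doubledFrame s b) = if a = b then 4 else 0 := by
  have h1 (v) : inner ℝ (doubledFrame s a) (s v) = ((2 * axisLabels a v : ℤ) : ℝ) := by
    rw [real_inner_comm, inner_doubledFrame (fun u => (real_inner_comm _ _).trans (hs u v)),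
      doubledFrame_partialCartan]
  rw [inner_doubledFrame h1]
  have h2 := map_doubledFrame (axisLabels a) (AddMonoidHom.mulLeft (2 : ℤ)) b
  simp only [AddMonoidHom.coe_mulLeft, doubledFrame_axisLabels] at h2
  rw [← h2]
  split_ifs <;> norm_num

/-- A vector of squared length `2` outside the span of the diagram projects to a vector of squared
length less than `2`; in the frame `doubledFrame s / 2` its coordinates are `doubledFrame x / 2`. -/
lemma sum_sq_doubledFrame_lt {s : TailVertex p q → E} {x : TailVertex p q → ℤ} {g : E}
    (hs : ∀ u v, inner ℝ (s u) (s v) = ((twoTailDiagram p q).partialCartan u v : ℝ))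
    (hg : inner ℝ g g = (2 : ℝ)) (hspan : g ∉ Submodule.span ℝ (Set.range s))
    (hx : ∀ v, inner ℝ g (s v) = x v) :
    ∑ a, doubledFrame x a ^ 2 < 8 := by
  let proj : E := ∑ a, (((doubledFrame x a : ℤ) : ℝ) / 4) • doubledFrame s a
  have hne : g - proj ≠ 0 := by
    intro h
    rw [sub_eq_zero.1 h] at hspan
    exact hspan (sum_mem fun a _ => Submodule.smul_mem _ _ (doubledFrame_mem_span s a))
  have hgp : inner ℝ g proj = ∑ a, ((doubledFrame x a : ℤ) : ℝ) ^ 2 / 4 := by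
    simp only [proj, inner_sum, inner_smul_right, inner_doubledFrame hx]
    exact Finset.sum_congr rfl fun a _ => by ring
  have hpp : inner ℝ proj proj = ∑ a, ((doubledFrame x a : ℤ) : ℝ) ^ 2 / 4 := by
    simp only [proj, inner_sum, sum_inner, inner_smul_right, inner_smul_left,
      inner_doubledFrame_doubledFrame hs, conj_trivial]
    simp only [mul_ite, mul_zero, Finset.sum_ite_eq', Finset.mem_univ, if_true]
    exact Finset.sum_congr rfl fun a _ => by ring
  have hpos : 0 < inner ℝ (g - proj) (g - proj) := real_inner_self_pos.2 hne
  rw [inner_sub_left, inner_sub_right, inner_sub_right, real_inner_comm g proj, hg, hgp, hpp,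
    ← Finset.sum_div] at hpos
  have : (∑ a, ((doubledFrame x a : ℤ) : ℝ) ^ 2) < 8 := by linarith
  exact_mod_cast this

end Projection

/-- In rank at least `8` the half-integral vectors of the dual lattice of `D_l` have squared length
at least `l / 4 ≥ 2`, so a short one is integral, and a unit vector up to sign. -/
lemma mem_range_labels_of_sum_sq_lt (hpq : 6 ≤ p + q) {x : TailVertex p q → ℤ} (hx : x ≠ 0)
    (hlt : ∑ a, doubledFrame x a ^ 2 < 8) :
    x ∈ Set.range (labels (p := p) (q := q)) := by
  have heven : ∀ a, 2 ∣ doubledFrame x a := by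
    by_contra! h
    obtain ⟨a, ha⟩ := h
    have hodd (b) : 1 ≤ doubledFrame x b ^ 2 := by
      have hb : doubledFrame x b ≠ 0 := by
        have := two_dvd_doubledFrame_sub x a b
        lia
      exact Order.one_le_iff_pos.2 (by positivity)
    have := Finset.card_nsmul_le_sum Finset.univ _ 1 fun b _ => hodd b
    simp only [Finset.card_univ, Fintype.card_sum, Fintype.card_fin, nsmul_eq_mul] at this
    push_cast at this
    lia
  choose c hc using heven
  have hc1 : ∑ a, c a ^ 2 < 2 := by
    have h4 : ∑ a, doubledFrame x a ^ 2 = 4 * ∑ a, c a ^ 2 := by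
      rw [Finset.mul_sum]
      exact Finset.sum_congr rfl fun a _ => by rw [hc]; ring
    lia
  obtain ⟨a, ha⟩ : ∃ a, c a ≠ 0 := by
    by_contra! h
    refine hx (doubledFrame_injective ?_)
    rw [doubledFrame_zero]
    funext a
    simp [hc, h]
  have hpos : 1 ≤ c a ^ 2 := Order.one_le_iff_pos.2 (by positivity)
  have hsplit := Finset.add_sum_erase Finset.univ (fun a => c a ^ 2) (Finset.mem_univ a)
  have hother : ∀ b, b ≠ a → c b = 0 := by
    intro b hb
    have hle := Finset.single_le_sum (f := fun b => c b ^ 2) (fun b _ => sq_nonneg _)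
      (Finset.mem_erase.2 ⟨hb, Finset.mem_univ b⟩)
    exact pow_eq_zero_iff two_ne_zero |>.1 (le_antisymm (by lia) (sq_nonneg _))
  have hunit : IsUnit (c a) := by
    have hnn := Finset.sum_nonneg (s := Finset.univ.erase a) fun b _ => sq_nonneg (c b)
    have h1 : c a ^ 2 = 1 := by lia
    exact IsUnit.of_mul_eq_one (c a) (by rw [← h1]; ring)
  obtain ⟨ε, hε⟩ := hunit
  refine ⟨ofAxis ε a, doubledFrame_injective ?_⟩
  funext b
  rw [doubledFrame_labels, hc]
  split_ifs with h
  · rw [hε, h]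
  · rw [hother b (Ne.symm h), mul_zero]

lemma mem_range_labels_of_isLinkageLabels (hpq : 6 ≤ p + q) {x : TailVertex p q → ℤ}
    (hx : (twoTailDiagram p q).IsLinkageLabels x) : x ∈ Set.range (labels (p := p) (q := q)) := by
  obtain ⟨hx0, ι, _, n, P, s, g, hP, -, hs, hspan, hx⟩ := hx
  refine mem_range_labels_of_sum_sq_lt hpq hx0 (sum_sq_doubledFrame_lt hs ?_ hspan hx)
  rw [← hP.toLinearMap_eq, ← hP.coroot_eq g, ← P.root_coroot_two g, hP.coroot_eq g]

theorem linkageSystemIsWindRose_twoTailDiagram (hpq : 6 ≤ p + q) :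
    LinkageSystemIsWindRose (twoTailDiagram p q) where
  injective := labels_injective
  complete := Set.Subset.antisymm (fun _ hx => mem_range_labels_of_isLinkageLabels hpq hx)
    (by rintro _ ⟨a, rfl⟩; exact isLinkageLabels_labels a)
  edges v a b := by
    rw [edge_iff_dualReflection]
    exact ⟨fun ⟨_, _, hne, h⟩ => ⟨fun hab => hne (by rw [hab]), h⟩,
      fun ⟨hne, h⟩ => ⟨isLinkageLabels_labels a, isLinkageLabels_labels b,
        labels_injective.ne hne, h⟩⟩
  transitive := exists_dualPartialWeylGroup_labels

/-! ### The end nodes of the arms -/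

lemma unitLabels_tau (ε : ℤˣ) (i : Fin p) (hi : (i : ℕ) + 1 = p) :
    unitLabels (.tau i : TailVertex p q) ε = (WindRose.tau ε (Fin.last p)).labels := by
  have hp : p ≠ 0 := by lia
  funext v
  cases v with
  | tau j =>
    have hj : (j : ℕ) ≠ p := j.2.ne
    have : (j : ℕ) + 1 = p ↔ j = i := by rw [Fin.ext_iff]; lia
    simp [unitLabels, labels, Pi.single_apply, hj, this]
  | _ => simp [unitLabels, labels, hp]

lemma unitLabels_phi (ε : ℤˣ) (i : Fin q) (hi : (i : ℕ) + 1 = q) :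
    unitLabels (.phi i : TailVertex p q) ε = (WindRose.phi (-ε) (Fin.last q)).labels := by
  have hq : q ≠ 0 := by lia
  funext v
  cases v with
  | phi j =>
    have hj : (j : ℕ) ≠ q := j.2.ne
    have : (j : ℕ) + 1 = q ↔ j = i := by rw [Fin.ext_iff]; lia
    simp [unitLabels, labels, Pi.single_apply, hj, this]
    split_ifs <;> simp
  | _ => simp [unitLabels, labels, hq]

theorem mainTheorem1 :
    -- the four endpoint vectors, at `τ_{k-1}` and at `φ_{l-k-3}` (with `τ_0 = β₁`, `φ_0 = β₂`)
    (∀ (l k : ℕ) (hk : 1 ≤ k) (hl : k + 3 ≤ l),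
      (carterD l k).IsLinkageLabels (unitLabels (.tau ⟨k - 1, by omega⟩) 1) ∧
      (carterD l k).IsLinkageLabels (unitLabels (.tau ⟨k - 1, by omega⟩) (-1)) ∧
      (carterD l k).IsLinkageLabels (unitLabels (.phi ⟨l - k - 3, by omega⟩) 1) ∧
      (carterD l k).IsLinkageLabels (unitLabels (.phi ⟨l - k - 3, by omega⟩) (-1))) ∧
    -- the linkage system of `D_l(a_k)` for `l > 7`
    (∀ l k : ℕ, 7 < l → 1 ≤ k → k + 3 ≤ l → LinkageSystemIsWindRose (carterD l k)) ∧
    -- the linkage system of `D_l` for `l > 7`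
    (∀ l : ℕ, 7 < l → LinkageSystemIsWindRose (dynkinD l)) := by
  refine ⟨fun l k hk hl => ?_, fun l k hl hk hkl => linkageSystemIsWindRose_twoTailDiagram (by lia),
    fun l hl => linkageSystemIsWindRose_twoTailDiagram (by lia)⟩
  have ht (ε : ℤˣ) : (carterD l k).IsLinkageLabels (unitLabels (.tau ⟨k - 1, by omega⟩) ε) := by
    rw [unitLabels_tau ε ⟨k - 1, by omega⟩ (by simp only; lia)]
    exact isLinkageLabels_labels _
  have hf (ε : ℤˣ) : (carterD l k).IsLinkageLabels (unitLabels (.phi ⟨l - k - 3, by omega⟩) ε) := by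
    rw [unitLabels_phi ε ⟨l - k - 3, by omega⟩ (by simp only; lia)]
    exact isLinkageLabels_labels _
  exact ⟨ht 1, ht (-1), hf 1, hf (-1)⟩
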